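/- Let $k$ be an algebraically closed field (of arbitrary characteristic) and let $A = k[X,Y]$ be the polynomial ring in two variables over $k$. For $G \in A$, say that $A/(G)$ is *$k$-rational* if $G$ is an irreducible element of $A$ and the field of fractions of $A/(G)$ is isomorphic, as an extension of $k$, to the rational function field $k(T)$ in one variable. Then for every $F \in A$ the following conditions are equivalent: 1. $A/(F-\lambda)$ is $k$-rational for infinitely many $\lambda \in k$; 2. $A/(F-\lambda)$ is $k$-rational for all but finitely many $\lambda \in k$. -/

import Mathlib

/-- For a field `k` and `F` in the polynomial ring `A = k[X, Y]`: the quotient `A/(F)` is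
`k`-rational, i.e. `F` is an irreducible element of `A` and the field of fractions of `A/(F)` is
isomorphic, as an extension of `k`, to the rational function field `k(T)` in one variable. -/
def IsRationalQuotient {k : Type*} [Field k] (F : MvPolynomial (Fin 2) k) : Prop :=
  Irreducible F ∧
    Nonempty (FractionRing (MvPolynomial (Fin 2) k ⧸ Ideal.span {F}) ≃ₐ[k] RatFunc k)

/-! The set of `c` for which the fibre `F = c` is rational turns out to be constructible in the
affine line, hence finite or cofinite; `k` being infinite, both implications follow. By Lüroth, an
irreducible plane curve is rational iff it has a nonconstant parametrization over `k(T)`. A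
birational one has coordinates of degree at most `deg F` (`max_natDegree_le_totalDegree`), since
`[k(T) : k(y)] = deg y`. So both irreducibility and parametrizability concern polynomials of bounded
degree: they are (non)existence of solutions to polynomial conditions on finitely many coefficients,
with `c` as a further coordinate. Chevalley's theorem and the Nullstellensatz
(`finiteOrCofinite_values`) handle such conditions. -/

/-- A set that is finite or has a finite complement. -/
def FiniteOrCofinite {α : Type*} (s : Set α) : Prop := s.Finite ∨ sᶜ.Finite

namespace FiniteOrCofinite

variable {α : Type*} {s t : Set α}

theorem compl (hs : FiniteOrCofinite s) : FiniteOrCofinite sᶜ := by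
  rcases hs with h | h
  · exact Or.inr (by rwa [compl_compl])
  · exact Or.inl h

theorem union (hs : FiniteOrCofinite s) (ht : FiniteOrCofinite t) : FiniteOrCofinite (s ∪ t) := by
  rcases hs with h | h
  · rcases ht with h' | h'
    · exact Or.inl (h.union h')
    · exact Or.inr (h'.subset (Set.compl_subset_compl.2 Set.subset_union_right))
  · exact Or.inr (h.subset (Set.compl_subset_compl.2 Set.subset_union_left))

theorem inter (hs : FiniteOrCofinite s) (ht : FiniteOrCofinite t) : FiniteOrCofinite (s ∩ t) := by
  have := (hs.compl.union ht.compl).compl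
  rwa [Set.compl_union, compl_compl, compl_compl] at this

theorem iUnion {ι : Type*} [Finite ι] {s : ι → Set α} (hs : ∀ i, FiniteOrCofinite (s i)) :
    FiniteOrCofinite (⋃ i, s i) := by
  by_cases h : ∃ i, (s i)ᶜ.Finite
  · obtain ⟨i, hi⟩ := h
    exact Or.inr (hi.subset (Set.compl_subset_compl.2 (Set.subset_iUnion s i)))
  · push Not at h
    exact Or.inl (Set.finite_iUnion fun i => (hs i).resolve_right (h i))

end FiniteOrCofinite

/-! ### Constructible subsets of the affine line -/

/-- The closed point of the affine line `Spec k[T]` with coordinate `c`. -/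
noncomputable def linePoint {k : Type*} [Field k] (c : k) : PrimeSpectrum (Polynomial k) :=
  ⟨RingHom.ker (Polynomial.evalRingHom c), RingHom.ker_isPrime _⟩

theorem mem_linePoint {k : Type*} [Field k] {c : k} {f : Polynomial k} :
    f ∈ (linePoint c).asIdeal ↔ f.eval c = 0 := Iff.rfl

/-- A closed set is the whole line or lies in the zeros of a nonzero polynomial; Boolean operations
preserve the dichotomy. -/
theorem finiteOrCofinite_linePoint_preimage {k : Type*} [Field k]
    {Z : Set (PrimeSpectrum (Polynomial k))} (hZ : Topology.IsConstructible Z) :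
    FiniteOrCofinite (linePoint ⁻¹' Z) := by
  induction hZ using Topology.IsConstructible.empty_union_induction with
  | open_retrocompact U hU _ =>
    obtain ⟨s, hs⟩ := (PrimeSpectrum.isOpen_iff U).1 hU
    classical
    by_cases h : ∃ f ∈ s, f ≠ 0
    · obtain ⟨f, hf, hf0⟩ := h
      refine Or.inr ((f.roots.toFinset.finite_toSet).subset fun c hc => ?_)
      rw [← Set.preimage_compl, hs] at hc
      have : f.eval c = 0 := hc hf
      simpa [hf0] using this
    · push Not at h
      refine Or.inl (Set.Finite.subset Set.finite_empty fun c hc => ?_)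
      have : linePoint c ∈ Uᶜ := by
        rw [hs]
        intro f hf
        rw [h f hf]
        exact Ideal.zero_mem _
      exact this hc
  | union s hs t ht h₁ h₂ => exact h₁.union h₂
  | compl s hs h => exact h.compl

/-- The values of a regular function on a quasi-affine variety over an algebraically closed field
form a finite or cofinite set. -/
theorem finiteOrCofinite_values {k σ : Type*} [Field k] [IsAlgClosed k] [Finite σ]
    (P : Set (MvPolynomial σ k)) (v t : MvPolynomial σ k) :
    FiniteOrCofinite {c : k | ∃ x : σ → k, (∀ p ∈ P, MvPolynomial.eval x p = 0) ∧
      MvPolynomial.eval x v ≠ 0 ∧ MvPolynomial.eval x t = c} := by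
  let φ : Polynomial k →+* MvPolynomial σ k := (Polynomial.aeval t).toRingHom
  have hφ : φ.FinitePresentation := by
    rw [← RingHom.FinitePresentation.of_finiteType]
    refine RingHom.FiniteType.of_comp_finiteType (f := Polynomial.C) ?_
    have : φ.comp Polynomial.C = algebraMap k (MvPolynomial σ k) := by
      ext a
      simp [φ, MvPolynomial.algebraMap_eq]
    rw [this, RingHom.finiteType_algebraMap]
    infer_instance
  have hZ : Topology.IsConstructible
      (PrimeSpectrum.zeroLocus P ∩ (PrimeSpectrum.basicOpen v : Set _)) := by
    refine .inter ?_ PrimeSpectrum.isConstructible_basicOpen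
    rw [← Topology.isConstructible_compl]
    have : IsOpen (PrimeSpectrum.zeroLocus P)ᶜ := (PrimeSpectrum.isClosed_zeroLocus P).isOpen_compl
    exact (TopologicalSpace.NoetherianSpace.isCompact _).isConstructible this
  -- Chevalley: the image of a constructible set under `Spec φ` is constructible.
  convert finiteOrCofinite_linePoint_preimage
    (PrimeSpectrum.isConstructible_comap_image hφ hZ) using 1
  ext c
  simp only [Set.mem_ofPred_eq, Set.mem_preimage, Set.mem_image]
  constructor
  · rintro ⟨x, hP, hv, rfl⟩
    refine ⟨⟨RingHom.ker (MvPolynomial.eval x), RingHom.ker_isPrime _⟩, ⟨hP, hv⟩, ?_⟩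
    ext f
    rw [mem_linePoint]
    change MvPolynomial.eval x (Polynomial.aeval t f) = 0 ↔ _
    rw [Polynomial.aeval_def, Polynomial.hom_eval₂, Polynomial.eval, iff_iff_eq]
    congr 2
    ext a
    simp [MvPolynomial.algebraMap_eq]
  · rintro ⟨p, ⟨hP, hv⟩, hp⟩
    have := p.isPrime
    have ht : t - MvPolynomial.C c ∈ p.asIdeal := by
      have : (Polynomial.X - Polynomial.C c) ∈ (linePoint c).asIdeal := by simp [mem_linePoint]
      rw [← hp] at this
      simpa [φ, MvPolynomial.algebraMap_eq] using this
    -- Nullstellensatz: the prime `p` is traded for a `k`-point of its zero locus where `v` does not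
    -- vanish.
    have hv' : v ∉ MvPolynomial.vanishingIdeal k (MvPolynomial.zeroLocus k p.asIdeal) := by
      rw [MvPolynomial.IsPrime.vanishingIdeal_zeroLocus]
      exact hv
    rw [MvPolynomial.mem_vanishingIdeal_iff] at hv'
    push Not at hv'
    obtain ⟨x, hx, hxv⟩ := hv'
    refine ⟨x, fun q hq => ?_, ?_, ?_⟩
    · simpa [MvPolynomial.aeval_eq_eval] using hx q (hP hq)
    · simpa [MvPolynomial.aeval_eq_eval] using hxv
    · simpa [MvPolynomial.aeval_eq_eval, sub_eq_zero] using hx _ ht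

/-! ### Rational plane curves and their parametrizations -/

/-- A prime ideal of `k[X, Y]` strictly containing the ideal of an irreducible polynomial is
maximal. -/
theorem isMaximal_of_span_irreducible_lt {k : Type*} [Field k] {G : MvPolynomial (Fin 2) k}
    (hG : Irreducible G) {p : Ideal (MvPolynomial (Fin 2) k)} (hp : p.IsPrime)
    (h : Ideal.span {G} < p) : p.IsMaximal := by
  obtain ⟨m, hm, hpm⟩ := p.exists_le_maximal hp.ne_top
  rcases hpm.eq_or_lt with rfl | hlt
  · exact hm
  exfalso
  have hGp : (Ideal.span {G}).IsPrime :=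
    (Ideal.span_singleton_prime hG.ne_zero).2 hG.prime
  have h0 : (⊥ : Ideal (MvPolynomial (Fin 2) k)) < Ideal.span {G} := by
    rw [bot_lt_iff_ne_bot, Ne, Ideal.span_singleton_eq_bot]
    exact hG.ne_zero
  -- A chain of four primes would have length 3, exceeding the dimension 2.
  let a : Fin 4 → PrimeSpectrum (MvPolynomial (Fin 2) k) :=
    ![⟨⊥, Ideal.isPrime_bot⟩, ⟨Ideal.span {G}, hGp⟩, ⟨p, hp⟩, ⟨m, hm.isPrime⟩]
  have ha : StrictMono a := by
    rw [Fin.strictMono_iff_lt_succ]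
    intro i
    fin_cases i
    · exact h0
    · exact h
    · exact hlt
  let l : LTSeries (PrimeSpectrum (MvPolynomial (Fin 2) k)) :=
    LTSeries.mk 3 a ha
  have hl := Order.LTSeries.length_le_krullDim l
  have hd : ringKrullDim (MvPolynomial (Fin 2) k) = 2 := by
    rw [MvPolynomial.ringKrullDim_of_isNoetherianRing]
    simp
  rw [ringKrullDim] at hd
  rw [hd] at hl
  norm_cast at hl

/-- The kernel of a nonconstant point of the curve `G = 0` over an extension of `k`. -/
theorem ker_aeval_eq_span_of_irreducible {k L : Type*} [Field k] [IsAlgClosed k] [Field L]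
    [Algebra k L] {G : MvPolynomial (Fin 2) k} (hG : Irreducible G) {x : Fin 2 → L}
    (hx : MvPolynomial.aeval x G = 0) (hnc : ∃ i, x i ∉ (algebraMap k L).range) :
    RingHom.ker (MvPolynomial.aeval (R := k) x) = Ideal.span {G} := by
  have hle : Ideal.span {G} ≤ RingHom.ker (MvPolynomial.aeval (R := k) x) := by
    rw [Ideal.span_singleton_le_iff_mem]
    exact hx
  by_contra hne
  -- A larger kernel would be the ideal of a `k`-point `c`, forcing every `x i` to be the constant
  -- `c i`.
  have hmax := isMaximal_of_span_irreducible_lt hG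
    (RingHom.ker_isPrime (MvPolynomial.aeval (R := k) x)) (lt_of_le_of_ne hle (Ne.symm hne))
  obtain ⟨c, hc⟩ := MvPolynomial.isMaximal_iff_eq_vanishingIdeal_singleton.1 hmax
  obtain ⟨i, hi⟩ := hnc
  apply hi
  have : MvPolynomial.X i - MvPolynomial.C (c i) ∈ RingHom.ker (MvPolynomial.aeval (R := k) x) := by
    rw [hc, MvPolynomial.mem_vanishingIdeal_singleton_iff]
    simp
  rw [RingHom.mem_ker] at this
  refine ⟨c i, ?_⟩
  rw [map_sub, MvPolynomial.aeval_X, MvPolynomial.aeval_C, sub_eq_zero] at this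
  exact this.symm

/-- The field of fractions of a nonconstant `k`-subalgebra of `k(T)` is isomorphic to `k(T)`. -/
theorem nonempty_fractionRing_algEquiv_ratFunc {k B : Type*} [Field k] [CommRing B] [IsDomain B]
    [Algebra k B] {f : B →ₐ[k] RatFunc k} (hf : Function.Injective f) {b : B}
    (hb : f b ∉ (algebraMap k (RatFunc k)).range) :
    Nonempty (FractionRing B ≃ₐ[k] RatFunc k) := by
  let g : FractionRing B →ₐ[k] RatFunc k := IsFractionRing.liftAlgHom (g := f) hf
  have hE : g.fieldRange ≠ ⊥ := by
    intro h
    have hmem : f b ∈ g.fieldRange := ⟨algebraMap _ _ b, IsFractionRing.lift_algebraMap hf b⟩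
    rw [h, IntermediateField.mem_bot] at hmem
    exact hb hmem
  exact ⟨(AlgEquiv.ofInjectiveField g).trans (RatFunc.Luroth.algEquiv hE).symm⟩

/-- An irreducible plane curve with a nonconstant rational parametrization is rational. -/
theorem isRationalQuotient_of_aeval_eq_zero {k : Type*} [Field k] [IsAlgClosed k]
    {G : MvPolynomial (Fin 2) k} (hG : Irreducible G) {x : Fin 2 → RatFunc k}
    (hx : MvPolynomial.aeval x G = 0) (hnc : ∃ i, x i ∉ (algebraMap k (RatFunc k)).range) :
    IsRationalQuotient G := by
  refine ⟨hG, ?_⟩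
  have hker := ker_aeval_eq_span_of_irreducible hG hx hnc
  have hGp : (Ideal.span {G}).IsPrime :=
    (Ideal.span_singleton_prime hG.ne_zero).2 hG.prime
  let f : (MvPolynomial (Fin 2) k ⧸ Ideal.span {G}) →ₐ[k] RatFunc k :=
    Ideal.Quotient.liftₐ (Ideal.span {G}) (MvPolynomial.aeval x) fun a ha => by
      rw [← hker] at ha
      exact ha
  have hf : Function.Injective f := by
    rw [injective_iff_map_eq_zero]
    intro a ha
    obtain ⟨a, rfl⟩ := Ideal.Quotient.mk_surjective a
    rw [Ideal.Quotient.eq_zero_iff_mem, ← hker]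
    exact ha
  obtain ⟨i, hi⟩ := hnc
  refine nonempty_fractionRing_algEquiv_ratFunc hf
    (b := Ideal.Quotient.mk (Ideal.span {G}) (MvPolynomial.X i)) ?_
  have : f (Ideal.Quotient.mk (Ideal.span {G}) (MvPolynomial.X i)) = x i :=
    MvPolynomial.aeval_X x i
  rwa [this]

theorem eval₂_aeval_finSuccEquiv {k L : Type*} [Field k] [CommRing L] [Algebra k L] {n : ℕ}
    (x : Fin (n + 1) → L) (G : MvPolynomial (Fin (n + 1)) k) :
    Polynomial.eval₂ (MvPolynomial.aeval (R := k) (Fin.tail x)).toRingHom (x 0)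
      (MvPolynomial.finSuccEquiv k n G) = MvPolynomial.aeval x G := by
  induction G using MvPolynomial.induction_on with
  | C a => simp [MvPolynomial.finSuccEquiv_apply]
  | add p q hp hq => rw [map_add, Polynomial.eval₂_add, hp, hq, map_add]
  | mul_X p i hp =>
    rw [map_mul, Polynomial.eval₂_mul, hp, map_mul, MvPolynomial.aeval_X]
    congr 1
    cases i using Fin.cases with
    | zero => simp [MvPolynomial.finSuccEquiv_X_zero]
    | succ j => simp [MvPolynomial.finSuccEquiv_X_succ, Fin.tail]

/-- If `x` and `y` generate `k(T)` and satisfy an equation `G(x, y) = 0`, then the degree of `y` as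
a rational function is at most the degree of `G`. -/
theorem max_natDegree_le_totalDegree {k : Type*} [Field k] {G : MvPolynomial (Fin 2) k}
    (hG : G ≠ 0) {x : Fin 2 → RatFunc k} (hx : MvPolynomial.aeval x G = 0)
    (htop : IntermediateField.adjoin k (Set.range x) = ⊤) :
    max (x 1).num.natDegree (x 1).denom.natDegree ≤ G.totalDegree := by
  by_cases hc : ∃ c, x 1 = RatFunc.C c
  · obtain ⟨h₁, h₂⟩ := (RatFunc.eq_C_iff (x 1)).1 hc
    simp [h₁, h₂]
  have htr := RatFunc.transcendental_of_ne_C (x 1) hc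
  rw [← RatFunc.finrank_eq_max_natDegree]
  let K := IntermediateField.adjoin k {x 1}
  let y : K := IntermediateField.AdjoinSimple.gen k (x 1)
  -- As `y` is transcendental, substituting it into the coefficients keeps `g` nonzero.
  have hinj : Function.Injective
      (MvPolynomial.aeval (R := k) (fun _ : Fin 1 => y)) := by
    have hy : Transcendental k y := by
      rwa [← transcendental_algebraMap_iff (FaithfulSMul.algebraMap_injective K (RatFunc k))]
    exact algebraicIndependent_unique_type_iff.2 hy
  let g : Polynomial K := (MvPolynomial.finSuccEquiv k 1 G).map
    (MvPolynomial.aeval (R := k) (fun _ : Fin 1 => y)).toRingHom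
  have hg : g ≠ 0 := by
    rw [Polynomial.map_ne_zero_iff hinj]
    simpa using hG
  have hgx : Polynomial.aeval (x 0) g = 0 := by
    rw [← hx]
    change Polynomial.aeval (x 0) ((MvPolynomial.finSuccEquiv k 1 G).map _) = _
    rw [Polynomial.aeval_def, Polynomial.eval₂_map, ← eval₂_aeval_finSuccEquiv]
    congr 1
    ext i
    · simp
    · rw [Subsingleton.elim i 0]
      simp [Fin.tail, y]
  -- `k(T)` is generated over `k(y)` by `x 0`, a root of `g`, so its degree is at most that of `g`.
  have hKtop : IntermediateField.adjoin K {x 0} = ⊤ := by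
    rw [← IntermediateField.restrictScalars_eq_top_iff (K := k),
      IntermediateField.restrictScalars_adjoin, _root_.eq_top_iff, ← htop,
      IntermediateField.adjoin_le_iff]
    rintro _ ⟨i, rfl⟩
    apply IntermediateField.subset_adjoin
    fin_cases i
    · exact Or.inr rfl
    · exact Or.inl (IntermediateField.mem_adjoin_simple_self k (x 1))
  have hint : IsIntegral K (x 0) := IsAlgebraic.isIntegral ⟨g, hg, hgx⟩
  have h1 := IntermediateField.adjoin.finrank hint
  rw [hKtop, IntermediateField.finrank_top'] at h1
  change Module.finrank K (RatFunc k) ≤ _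
  rw [h1]
  calc (minpoly K (x 0)).natDegree ≤ g.natDegree :=
        Polynomial.natDegree_le_of_dvd (minpoly.dvd K _ hgx) hg
    _ ≤ (MvPolynomial.finSuccEquiv k 1 G).natDegree := Polynomial.natDegree_map_le
    _ = G.degreeOf 0 := MvPolynomial.natDegree_finSuccEquiv G
    _ ≤ G.totalDegree := MvPolynomial.degreeOf_le_totalDegree G 0

/-- The images of the coordinate functions generate `k(T)`, so they are not all constant and the
degree bound applies to each. -/
theorem exists_aeval_eq_zero_of_isRationalQuotient {k : Type*} [Field k]
    {G : MvPolynomial (Fin 2) k} (h : IsRationalQuotient G) :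
    ∃ x : Fin 2 → RatFunc k, MvPolynomial.aeval x G = 0 ∧
      (∃ i, x i ∉ (algebraMap k (RatFunc k)).range) ∧
      ∀ i, max (x i).num.natDegree (x i).denom.natDegree ≤ G.totalDegree := by
  obtain ⟨hG, ⟨e⟩⟩ := h
  have hGp : (Ideal.span {G}).IsPrime :=
    (Ideal.span_singleton_prime hG.ne_zero).2 hG.prime
  let f : MvPolynomial (Fin 2) k →ₐ[k] RatFunc k :=
    (e : _ →ₐ[k] RatFunc k).comp ((IsScalarTower.toAlgHom k
      (MvPolynomial (Fin 2) k ⧸ Ideal.span {G})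
      (FractionRing (MvPolynomial (Fin 2) k ⧸ Ideal.span {G}))).comp
        (Ideal.Quotient.mkₐ k (Ideal.span {G})))
  let x : Fin 2 → RatFunc k := fun i => f (MvPolynomial.X i)
  have hf : f = MvPolynomial.aeval x := by
    ext i
    simp [x]
  have hx : MvPolynomial.aeval x G = 0 := by
    rw [← hf]
    have : Ideal.Quotient.mk (Ideal.span {G}) G = 0 :=
      Ideal.Quotient.eq_zero_iff_mem.2 (Ideal.mem_span_singleton_self G)
    simp [f, this]
  have hmem : ∀ a, f a ∈ IntermediateField.adjoin k (Set.range x) := by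
    intro a
    rw [hf]
    have : MvPolynomial.aeval x a ∈ (MvPolynomial.aeval (R := k) x).range := ⟨a, rfl⟩
    rw [← Algebra.adjoin_range_eq_range_aeval] at this
    exact IntermediateField.algebra_adjoin_le_adjoin k _ this
  have htop : IntermediateField.adjoin k (Set.range x) = ⊤ := by
    rw [_root_.eq_top_iff]
    intro z _
    obtain ⟨w, rfl⟩ := e.surjective z
    obtain ⟨a, b, -, rfl⟩ := IsFractionRing.div_surjective
      (A := MvPolynomial (Fin 2) k ⧸ Ideal.span {G}) w
    obtain ⟨a, rfl⟩ := Ideal.Quotient.mk_surjective a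
    obtain ⟨b, rfl⟩ := Ideal.Quotient.mk_surjective b
    rw [map_div₀]
    exact div_mem (hmem a) (hmem b)
  refine ⟨x, hx, ?_, fun i => ?_⟩
  · by_contra! hcon
    have hbot : IntermediateField.adjoin k (Set.range x) = ⊥ := by
      rw [_root_.eq_bot_iff, IntermediateField.adjoin_le_iff]
      rintro _ ⟨i, rfl⟩
      exact IntermediateField.mem_bot.2 (hcon i)
    have hX : (RatFunc.X : RatFunc k) ∈ (⊥ : IntermediateField k (RatFunc k)) := by
      rw [← hbot, htop]
      trivial
    obtain ⟨c, hc⟩ := IntermediateField.mem_bot.1 hX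
    exact RatFunc.transcendental_X (hc ▸ isAlgebraic_algebraMap c)
  · fin_cases i
    · have := max_natDegree_le_totalDegree (G := MvPolynomial.rename (Equiv.swap 0 1) G)
        (x := x ∘ Equiv.swap 0 1)
        (by
          rw [Ne, map_eq_zero_iff _ (MvPolynomial.rename_injective _ (Equiv.injective _))]
          exact hG.ne_zero)
        (by rw [MvPolynomial.aeval_rename, Function.comp_assoc]; simpa [← Equiv.coe_trans] using hx)
        (by
          rw [Set.range_comp, (Equiv.swap (0 : Fin 2) 1).range_eq_univ, Set.image_univ]
          exact htop)
      simpa using this.trans (MvPolynomial.totalDegree_rename_le _ _)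
    · exact max_natDegree_le_totalDegree hG.ne_zero hx htop

/-! ### Irreducibility of the fibres -/

/-- A version of `finiteOrCofinite_values` for the conditions given by the vanishing of a polynomial
whose coefficients depend on parameters. -/
theorem finiteOrCofinite_of_mvPolynomial_map_eq_zero {k σ τ : Type*} [Field k] [IsAlgClosed k]
    [Finite σ] (Φ : MvPolynomial τ (MvPolynomial σ k)) (v t : MvPolynomial σ k) :
    FiniteOrCofinite {c : k | ∃ x : σ → k, MvPolynomial.map (MvPolynomial.eval x) Φ = 0 ∧
      MvPolynomial.eval x v ≠ 0 ∧ MvPolynomial.eval x t = c} := by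
  convert finiteOrCofinite_values (Set.range fun m => Φ.coeff m) v t using 6 with c x
  rw [Set.forall_mem_range, MvPolynomial.ext_iff]
  simp only [MvPolynomial.coeff_map, MvPolynomial.coeff_zero]

theorem finiteOrCofinite_of_polynomial_map_eq_zero {k σ : Type*} [Field k] [IsAlgClosed k]
    [Finite σ] (Φ : Polynomial (MvPolynomial σ k)) (v t : MvPolynomial σ k) :
    FiniteOrCofinite {c : k | ∃ x : σ → k, Φ.map (MvPolynomial.eval x) = 0 ∧
      MvPolynomial.eval x v ≠ 0 ∧ MvPolynomial.eval x t = c} := by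
  convert finiteOrCofinite_values (Set.range fun m => Φ.coeff m) v t using 6 with c x
  rw [Set.forall_mem_range, Polynomial.ext_iff]
  simp only [Polynomial.coeff_map, Polynomial.coeff_zero]

theorem sum_monomial_coeff_of_support_subset {τ R : Type*} [CommSemiring R]
    {M : Finset (τ →₀ ℕ)} {p : MvPolynomial τ R} (h : p.support ⊆ M) :
    ∑ m : M, MvPolynomial.monomial (m : τ →₀ ℕ) (p.coeff m) = p := by
  rw [Finset.sum_coe_sort M fun m => MvPolynomial.monomial m (p.coeff m)]
  conv_rhs => rw [p.as_sum]
  refine (Finset.sum_subset h fun m _ hm => ?_).symm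
  rw [MvPolynomial.notMem_support_iff.1 hm, MvPolynomial.monomial_zero]

theorem coeff_sum_monomial {τ R : Type*} [CommSemiring R] {M : Finset (τ →₀ ℕ)}
    (a : M → R) (m : M) :
    (∑ n : M, MvPolynomial.monomial (n : τ →₀ ℕ) (a n)).coeff (m : τ →₀ ℕ) = a m := by
  classical
  simp [MvPolynomial.coeff_sum, MvPolynomial.coeff_monomial]

theorem exists_coeff_ne_zero_of_not_isUnit {τ k : Type*} [Field k] {p : MvPolynomial τ k}
    (h0 : p ≠ 0) (hp : ¬ IsUnit p) : ∃ m, m ≠ 0 ∧ p.coeff m ≠ 0 := by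
  by_contra! h
  have hc : p = MvPolynomial.C (p.coeff 0) := by
    classical
    ext m
    rw [MvPolynomial.coeff_C]
    split_ifs with hm
    · rw [hm]
    · exact h m (Ne.symm hm)
  apply hp
  rw [hc]
  refine (isUnit_iff_ne_zero.2 ?_).map MvPolynomial.C
  intro h'
  rw [h', map_zero] at hc
  exact h0 hc

theorem not_isUnit_of_coeff_ne_zero {τ k : Type*} [Field k] {p : MvPolynomial τ k} {m : τ →₀ ℕ}
    (hm : m ≠ 0) (hp : p.coeff m ≠ 0) : ¬ IsUnit p := by
  classical
  intro h
  rw [MvPolynomial.isUnit_iff_eq_C_of_isReduced] at h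
  obtain ⟨r, -, rfl⟩ := h
  rw [MvPolynomial.coeff_C, if_neg (Ne.symm hm)] at hp
  exact hp rfl

/-- The constants `c` for which `F - c` admits a factorization `G * H` with the supports of `G` and
`H` in a given finite set and prescribed nonzero coefficients. -/
theorem finiteOrCofinite_setOf_factorization {k τ : Type*} [Field k] [IsAlgClosed k]
    (F : MvPolynomial τ k) {M : Finset (τ →₀ ℕ)} (m n : M) :
    FiniteOrCofinite {c : k | ∃ G H : MvPolynomial τ k, G.support ⊆ M ∧ H.support ⊆ M ∧
      F - MvPolynomial.C c = G * H ∧ G.coeff m ≠ 0 ∧ H.coeff n ≠ 0} := by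
  -- Coordinates: `none` is `c`; `inl` and `inr` index the coefficients of the two factors.
  let S := MvPolynomial (Option (M ⊕ M)) k
  let G : MvPolynomial τ S :=
    ∑ m : M, MvPolynomial.monomial (m : τ →₀ ℕ) (MvPolynomial.X (some (Sum.inl m)))
  let H : MvPolynomial τ S :=
    ∑ m : M, MvPolynomial.monomial (m : τ →₀ ℕ) (MvPolynomial.X (some (Sum.inr m)))
  let Φ : MvPolynomial τ S := MvPolynomial.map MvPolynomial.C F -
    MvPolynomial.C (MvPolynomial.X none) - G * H
  have hG (x : Option (M ⊕ M) → k) : MvPolynomial.map (MvPolynomial.eval x) G =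
      ∑ m : M, MvPolynomial.monomial (m : τ →₀ ℕ) (x (some (Sum.inl m))) := by
    simp [G, MvPolynomial.map_monomial]
  have hH (x : Option (M ⊕ M) → k) : MvPolynomial.map (MvPolynomial.eval x) H =
      ∑ m : M, MvPolynomial.monomial (m : τ →₀ ℕ) (x (some (Sum.inr m))) := by
    simp [H, MvPolynomial.map_monomial]
  have hC (x : Option (M ⊕ M) → k) :
      (MvPolynomial.eval x).comp MvPolynomial.C = RingHom.id k := by
    ext; simp
  have hsupp (a : M → k) :
      (∑ m : M, MvPolynomial.monomial (m : τ →₀ ℕ) (a m)).support ⊆ M := by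
    classical
    refine MvPolynomial.support_sum.trans (Finset.biUnion_subset.2 fun m _ => ?_)
    exact MvPolynomial.support_monomial_subset.trans (by simp)
  convert finiteOrCofinite_of_mvPolynomial_map_eq_zero Φ
    (MvPolynomial.X (some (Sum.inl m)) * MvPolynomial.X (some (Sum.inr n)))
    (MvPolynomial.X none) using 1
  ext c
  simp only [Set.mem_ofPred_eq, Φ, map_sub, map_mul, MvPolynomial.map_map, hC, hG, hH,
    MvPolynomial.map_C, MvPolynomial.eval_X, MvPolynomial.map_id, sub_eq_zero]
  constructor
  · rintro ⟨P, Q, hP, hQ, h, hm, hn⟩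
    refine ⟨fun i => i.elim c (Sum.elim (fun m => P.coeff m) fun m => Q.coeff m), ?_, ?_, rfl⟩
    · simp only [Option.elim, Sum.elim_inl, Sum.elim_inr, sum_monomial_coeff_of_support_subset hP,
        sum_monomial_coeff_of_support_subset hQ]
      exact h
    · simpa using ⟨hm, hn⟩
  · rintro ⟨x, h, hx, rfl⟩
    refine ⟨_, _, hsupp _, hsupp _, h, ?_, ?_⟩
    · rw [coeff_sum_monomial]
      exact left_ne_zero_of_mul hx
    · rw [coeff_sum_monomial]
      exact right_ne_zero_of_mul hx

/-- Factors of `F - c` have degree at most `deg F`, so their supports lie in one finite set `M`; a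
nonzero factor is a nonunit iff some nonconstant coefficient is nonzero. -/
theorem finiteOrCofinite_setOf_irreducible_sub_C {k τ : Type*} [Field k] [IsAlgClosed k] [Finite τ]
    {F : MvPolynomial τ k} (hF : ∀ c, F ≠ MvPolynomial.C c) :
    FiniteOrCofinite {c : k | Irreducible (F - MvPolynomial.C c)} := by
  classical
  have := Fintype.ofFinite τ
  let M : Finset (τ →₀ ℕ) := Finset.Iic (Finsupp.equivFunOnFinite.symm fun _ => F.totalDegree)
  have hM {p : MvPolynomial τ k} (hp : p.totalDegree ≤ F.totalDegree) : p.support ⊆ M := by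
    intro m hm
    rw [Finset.mem_Iic]
    intro i
    exact ((MvPolynomial.monomial_le_degreeOf i hm).trans
      (MvPolynomial.degreeOf_le_totalDegree p i)).trans hp
  have key := FiniteOrCofinite.iUnion fun m : {m : M // (m : τ →₀ ℕ) ≠ 0} =>
    FiniteOrCofinite.iUnion fun n : {m : M // (m : τ →₀ ℕ) ≠ 0} =>
      finiteOrCofinite_setOf_factorization F m.1 n.1
  convert key.compl using 1
  ext c
  have h0 : F - MvPolynomial.C c ≠ 0 := sub_ne_zero.2 (hF c)
  have hu : ¬ IsUnit (F - MvPolynomial.C c) := by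
    intro h
    rw [MvPolynomial.isUnit_iff_eq_C_of_isReduced] at h
    obtain ⟨r, -, h⟩ := h
    exact hF (r + c) (by rw [map_add, ← h, sub_add_cancel])
  rw [Set.mem_ofPred_eq, Set.mem_compl_iff, irreducible_iff, ← not_iff_not, not_not]
  simp only [Set.mem_iUnion, Set.mem_ofPred_eq, hu, not_false_eq_true, true_and]
  push Not
  constructor
  · rintro ⟨G, H, h, hG, hH⟩
    have hGH : G * H ≠ 0 := h ▸ h0
    have hG0 := left_ne_zero_of_mul hGH
    have hH0 := right_ne_zero_of_mul hGH
    have hd := MvPolynomial.totalDegree_sub_C_le F c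
    rw [h, MvPolynomial.totalDegree_mul_of_isDomain hG0 hH0] at hd
    have hGM := hM ((Nat.le_add_right _ _).trans hd)
    have hHM := hM ((Nat.le_add_left _ _).trans hd)
    obtain ⟨m, hm0, hm⟩ := exists_coeff_ne_zero_of_not_isUnit hG0 hG
    obtain ⟨n, hn0, hn⟩ := exists_coeff_ne_zero_of_not_isUnit hH0 hH
    exact ⟨⟨⟨m, hGM (MvPolynomial.mem_support_iff.2 hm)⟩, hm0⟩,
      ⟨⟨n, hHM (MvPolynomial.mem_support_iff.2 hn)⟩, hn0⟩, G, H, hGM, hHM, h, hm, hn⟩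
  · rintro ⟨m, n, G, H, -, -, h, hm, hn⟩
    exact ⟨G, H, h, not_isUnit_of_coeff_ne_zero m.2 hm, not_isUnit_of_coeff_ne_zero n.2 hn⟩

/-! ### Parametrizations of bounded degree -/

/-- The value at `(P, q)` of the homogenization of `F`. -/
noncomputable def homogenizedEval {k σ R : Type*} [Field k] [CommRing R] [Algebra k R]
    (F : MvPolynomial σ k) (P : σ → R) (q : R) : R :=
  ∑ m ∈ F.support, algebraMap k R (F.coeff m) * (m.prod fun i e => P i ^ e) *
    q ^ (F.totalDegree - m.degree)

theorem map_homogenizedEval {k σ R S : Type*} [Field k] [CommRing R] [Algebra k R]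
    [CommRing S] [Algebra k S] (φ : R →ₐ[k] S) (F : MvPolynomial σ k) (P : σ → R) (q : R) :
    φ (homogenizedEval F P q) = homogenizedEval F (fun i => φ (P i)) (φ q) := by
  simp [homogenizedEval, Finsupp.prod, map_prod]

theorem homogenizedEval_eq_mul_aeval {k σ L : Type*} [Field k] [Field L] [Algebra k L]
    (F : MvPolynomial σ k) (P : σ → L) {q : L} (hq : q ≠ 0) :
    homogenizedEval F P q = MvPolynomial.aeval (fun i => P i / q) F * q ^ F.totalDegree := by
  rw [MvPolynomial.aeval_def, MvPolynomial.eval₂_eq, Finset.sum_mul, homogenizedEval]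
  refine Finset.sum_congr rfl fun m hm => ?_
  -- On the support the truncated subtraction in the exponent is exact.
  have hle : m.degree ≤ F.totalDegree := MvPolynomial.le_totalDegree hm
  rw [mul_assoc, mul_assoc, ← Nat.sub_add_cancel hle, Nat.add_sub_cancel, pow_add]
  congr 1
  simp only [Finsupp.prod, div_pow, Finset.prod_div_distrib, Finset.prod_pow_eq_pow_sum]
  rw [← Finsupp.degree_apply]
  field_simp

theorem sum_C_coeff_mul_X_pow {R : Type*} [CommSemiring R] {D : ℕ} {p : Polynomial R}
    (hp : p.natDegree ≤ D) :
    ∑ j : Fin (D + 1), Polynomial.C (p.coeff j) * Polynomial.X ^ (j : ℕ) = p := by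
  rw [Fin.sum_univ_eq_sum_range fun j => Polynomial.C (p.coeff j) * Polynomial.X ^ j]
  exact (Polynomial.as_sum_range_C_mul_X_pow' p (Nat.lt_succ_of_le hp)).symm

theorem natDegree_sum_C_mul_X_pow_le {R : Type*} [CommSemiring R] {D : ℕ} (a : Fin (D + 1) → R) :
    (∑ j : Fin (D + 1), Polynomial.C (a j) * Polynomial.X ^ (j : ℕ)).natDegree ≤ D :=
  Polynomial.natDegree_sum_le_of_forall_le _ _ fun j _ =>
    (Polynomial.natDegree_C_mul_X_pow_le _ _).trans (Nat.lt_succ_iff.1 j.2)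

theorem coeff_sum_C_mul_X_pow {R : Type*} [CommSemiring R] {D : ℕ} (a : Fin (D + 1) → R)
    (j : Fin (D + 1)) :
    (∑ j : Fin (D + 1), Polynomial.C (a j) * Polynomial.X ^ (j : ℕ)).coeff j = a j := by
  simp [Polynomial.finsetSum_coeff, Polynomial.coeff_X_pow, Fin.val_inj]

/-- The constants `c` for which the homogenized equation `F = c` has a polynomial solution `(P, q)`
of bounded degree with a prescribed nonvanishing minor. -/
theorem finiteOrCofinite_setOf_parametrization {k σ : Type*} [Field k] [IsAlgClosed k] [Finite σ]
    (F : MvPolynomial σ k) {D : ℕ} (i : σ) (a b : Fin (D + 1)) :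
    FiniteOrCofinite {c : k | ∃ (P : σ → Polynomial k) (q : Polynomial k),
      (∀ i, (P i).natDegree ≤ D) ∧ q.natDegree ≤ D ∧
      homogenizedEval F P q = Polynomial.C c * q ^ F.totalDegree ∧
      (P i).coeff a * q.coeff b - (P i).coeff b * q.coeff a ≠ 0} := by
  -- Coordinates: `none` is `c`, `(none, j)` a coefficient of `q`, `(some i, j)` one of `P i`.
  let ι := Option (Option σ × Fin (D + 1))
  let g : Option σ → Polynomial (MvPolynomial ι k) := fun s =>
    ∑ j : Fin (D + 1), Polynomial.C (MvPolynomial.X (some (s, j))) * Polynomial.X ^ (j : ℕ)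
  let Φ : Polynomial (MvPolynomial ι k) := homogenizedEval F (fun i => g (some i)) (g none) -
    Polynomial.C (MvPolynomial.X none) * g none ^ F.totalDegree
  have hg (x : ι → k) (s : Option σ) : (g s).map (MvPolynomial.eval x) =
      ∑ j : Fin (D + 1), Polynomial.C (x (some (s, j))) * Polynomial.X ^ (j : ℕ) := by
    simp [g, Polynomial.map_sum]
  have hhom (x : ι → k) : (homogenizedEval F (fun i => g (some i)) (g none)).map
      (MvPolynomial.eval x) = homogenizedEval F (fun i => (g (some i)).map (MvPolynomial.eval x))
        ((g none).map (MvPolynomial.eval x)) := by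
    exact map_homogenizedEval (Polynomial.mapAlgHom (MvPolynomial.aeval (R := k) x)) F _ _
  convert finiteOrCofinite_of_polynomial_map_eq_zero Φ
    (MvPolynomial.X (some (some i, a)) * MvPolynomial.X (some (none, b)) -
      MvPolynomial.X (some (some i, b)) * MvPolynomial.X (some (none, a)))
    (MvPolynomial.X none) using 1
  ext c
  simp only [Set.mem_ofPred_eq, Φ, Polynomial.map_sub, Polynomial.map_mul, Polynomial.map_pow,
    hhom, hg, Polynomial.map_C, MvPolynomial.eval_X, map_sub, map_mul]
  constructor
  · rintro ⟨P, q, hP, hq, h, hm⟩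
    refine ⟨fun s => s.elim c fun s => s.1.elim (q.coeff s.2) fun i => (P i).coeff s.2,
      ?_, ?_, rfl⟩
    · simp only [Option.elim, sum_C_coeff_mul_X_pow hq, sum_C_coeff_mul_X_pow (hP _)]
      exact sub_eq_zero.2 h
    · exact hm
  · rintro ⟨x, h, hx, rfl⟩
    refine ⟨_, _, fun i => natDegree_sum_C_mul_X_pow_le _, natDegree_sum_C_mul_X_pow_le _,
      sub_eq_zero.1 h, ?_⟩
    simpa only [coeff_sum_C_mul_X_pow] using hx

/-- A quotient of polynomials is nonconstant exactly if some minor of the coefficients does not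
vanish. -/
theorem div_notMem_range_iff {k : Type*} [Field k] {D : ℕ} {p q : Polynomial k}
    (hp : p.natDegree ≤ D) (hq : q.natDegree ≤ D) :
    algebraMap (Polynomial k) (RatFunc k) p / algebraMap (Polynomial k) (RatFunc k) q ∉
        (algebraMap k (RatFunc k)).range ↔
      ∃ a b : Fin (D + 1), p.coeff a * q.coeff b - p.coeff b * q.coeff a ≠ 0 := by
  have hinj := RatFunc.algebraMap_injective k
  have hC (c : k) : algebraMap k (RatFunc k) c = algebraMap (Polynomial k) _ (Polynomial.C c) := by
    rw [IsScalarTower.algebraMap_apply k (Polynomial k) (RatFunc k), Polynomial.algebraMap_eq]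
  -- For `q = 0` the quotient is 0 by convention and all minors vanish, so both sides fail.
  rcases eq_or_ne q 0 with rfl | hq0
  · simp
  have hq0' : algebraMap (Polynomial k) (RatFunc k) q ≠ 0 :=
    (map_ne_zero_iff _ hinj).2 hq0
  rw [← not_iff_not, not_not]
  push Not
  constructor
  · rintro ⟨c, hc⟩ a b
    rw [eq_div_iff hq0', hC, ← map_mul] at hc
    rw [← hinj hc, Polynomial.coeff_C_mul, Polynomial.coeff_C_mul]
    ring
  · intro h
    have hlc : q.coeff q.natDegree ≠ 0 := Polynomial.leadingCoeff_ne_zero.2 hq0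
    refine ⟨p.coeff q.natDegree / q.coeff q.natDegree, ?_⟩
    rw [eq_div_iff hq0', hC, ← map_mul]
    congr 1
    ext j
    rw [Polynomial.coeff_C_mul]
    by_cases hj : j ≤ D
    · have := h ⟨j, Nat.lt_succ_of_le hj⟩ ⟨q.natDegree, Nat.lt_succ_of_le hq⟩
      simp only at this
      field_simp
      linear_combination -this
    · rw [not_le] at hj
      rw [Polynomial.coeff_eq_zero_of_natDegree_lt (hp.trans_lt hj),
        Polynomial.coeff_eq_zero_of_natDegree_lt (hq.trans_lt hj), mul_zero]

/-- A fibre `F = c` is a rational curve if and only if it is irreducible and has a nonconstant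
rational parametrization of degree at most `2 deg F`. -/
theorem isRationalQuotient_sub_C_iff {k : Type*} [Field k] [IsAlgClosed k]
    (F : MvPolynomial (Fin 2) k) (c : k) :
    IsRationalQuotient (F - MvPolynomial.C c) ↔ Irreducible (F - MvPolynomial.C c) ∧
      ∃ (i : Fin 2) (a b : Fin (2 * F.totalDegree + 1))
        (P : Fin 2 → Polynomial k) (q : Polynomial k),
        (∀ i, (P i).natDegree ≤ 2 * F.totalDegree) ∧ q.natDegree ≤ 2 * F.totalDegree ∧
        homogenizedEval F P q = Polynomial.C c * q ^ F.totalDegree ∧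
        (P i).coeff a * q.coeff b - (P i).coeff b * q.coeff a ≠ 0 := by
  have hinj := RatFunc.algebraMap_injective k
  have hhom (P : Fin 2 → Polynomial k) {q : Polynomial k} (hq : q ≠ 0) :
      homogenizedEval F P q = Polynomial.C c * q ^ F.totalDegree ↔
        MvPolynomial.aeval (fun i => algebraMap (Polynomial k) (RatFunc k) (P i) /
          algebraMap (Polynomial k) (RatFunc k) q) (F - MvPolynomial.C c) = 0 := by
    have hq' : algebraMap (Polynomial k) (RatFunc k) q ≠ 0 := (map_ne_zero_iff _ hinj).2 hq
    rw [← hinj.eq_iff]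
    change IsScalarTower.toAlgHom k (Polynomial k) (RatFunc k) _ = _ ↔ _
    rw [map_homogenizedEval]
    change homogenizedEval F (fun i => algebraMap (Polynomial k) (RatFunc k) (P i))
      (algebraMap (Polynomial k) (RatFunc k) q) = _ ↔ _
    rw [homogenizedEval_eq_mul_aeval F _ hq', map_mul, map_pow,
      mul_left_inj' (pow_ne_zero _ hq'), map_sub, sub_eq_zero, MvPolynomial.aeval_C,
      IsScalarTower.algebraMap_apply k (Polynomial k) (RatFunc k), Polynomial.algebraMap_eq]
  constructor
  · intro h
    refine ⟨h.1, ?_⟩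
    obtain ⟨x, hx, ⟨i, hi⟩, hdeg⟩ := exists_aeval_eq_zero_of_isRationalQuotient h
    have hdeg' (i : Fin 2) := (hdeg i).trans (MvPolynomial.totalDegree_sub_C_le F c)
    have hnum (i : Fin 2) := (le_max_left _ _).trans (hdeg' i)
    have hden (i : Fin 2) := (le_max_right _ _).trans (hdeg' i)
    -- Passing to the common denominator `q` doubles the degree bound; `i.rev` is the other index.
    let P : Fin 2 → Polynomial k := fun i => (x i).num * (x i.rev).denom
    let q : Polynomial k := (x 0).denom * (x 1).denom
    have hq : q ≠ 0 := mul_ne_zero (x 0).denom_ne_zero (x 1).denom_ne_zero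
    have hP (i : Fin 2) : (P i).natDegree ≤ 2 * F.totalDegree := by
      rw [two_mul]
      exact Polynomial.natDegree_mul_le.trans (add_le_add (hnum i) (hden _))
    have hqd : q.natDegree ≤ 2 * F.totalDegree := by
      rw [two_mul]
      exact Polynomial.natDegree_mul_le.trans (add_le_add (hden 0) (hden 1))
    have hxP (i : Fin 2) : algebraMap (Polynomial k) (RatFunc k) (P i) /
        algebraMap (Polynomial k) (RatFunc k) q = x i := by
      have h0 := RatFunc.algebraMap_ne_zero (x 0).denom_ne_zero
      have h1 := RatFunc.algebraMap_ne_zero (x 1).denom_ne_zero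
      conv_rhs => rw [← RatFunc.num_div_denom (x i)]
      simp only [P, q, map_mul]
      fin_cases i
      · exact mul_div_mul_right _ _ h1
      · rw [mul_comm (algebraMap (Polynomial k) (RatFunc k) (x 0).denom)]
        exact mul_div_mul_right _ _ h0
    obtain ⟨a, b, hab⟩ := (div_notMem_range_iff (hP i) hqd).1 (by rwa [hxP])
    refine ⟨i, a, b, P, q, hP, hqd, (hhom P hq).2 ?_, hab⟩
    simpa only [hxP] using hx
  · rintro ⟨hirr, i, a, b, P, q, hP, hqd, h, hab⟩
    have hq : q ≠ 0 := by
      rintro rfl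
      simp at hab
    exact isRationalQuotient_of_aeval_eq_zero hirr ((hhom P hq).1 h)
      ⟨i, (div_notMem_range_iff (hP i) hqd).2 ⟨a, b, hab⟩⟩

theorem finiteOrCofinite_setOf_isRationalQuotient {k : Type*} [Field k] [IsAlgClosed k]
    (F : MvPolynomial (Fin 2) k) :
    FiniteOrCofinite {c : k | IsRationalQuotient (F - MvPolynomial.C c)} := by
  by_cases hF : ∃ d, F = MvPolynomial.C d
  · obtain ⟨d, rfl⟩ := hF
    -- For constant `F`, each `F - c` is zero or a unit, so never irreducible.
    refine Or.inl (Set.finite_empty.subset fun c hc => ?_)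
    have hirr : Irreducible (MvPolynomial.C d - MvPolynomial.C c : MvPolynomial (Fin 2) k) := hc.1
    rw [← map_sub] at hirr
    refine hirr.not_isUnit ((isUnit_iff_ne_zero.2 fun h => hirr.ne_zero ?_).map MvPolynomial.C)
    rw [h, map_zero]
  · push Not at hF
    have key := (finiteOrCofinite_setOf_irreducible_sub_C hF).inter <|
      FiniteOrCofinite.iUnion fun i : Fin 2 =>
      FiniteOrCofinite.iUnion fun a : Fin (2 * F.totalDegree + 1) =>
      FiniteOrCofinite.iUnion fun b : Fin (2 * F.totalDegree + 1) =>
        finiteOrCofinite_setOf_parametrization F i a b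
    convert key using 1
    ext c
    simp only [Set.mem_ofPred_eq, Set.mem_inter_iff, Set.mem_iUnion]
    exact isRationalQuotient_sub_C_iff F c

theorem lemma2p3 {k : Type*} [Field k] [IsAlgClosed k] (F : MvPolynomial (Fin 2) k) :
    {c : k | IsRationalQuotient (F - MvPolynomial.C c)}.Infinite ↔
      {c : k | ¬ IsRationalQuotient (F - MvPolynomial.C c)}.Finite := by
  constructor
  · exact fun h => (finiteOrCofinite_setOf_isRationalQuotient F).resolve_left h
  · intro h
    have := IsAlgClosed.instInfinite (K := k)
    exact h.infinite_compl.mono fun c hc => not_not.1 hc
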